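/- Let $N\ge 1$, let $\xi^1\ge\xi^2\ge\dots\ge\xi^N$ be real samples with empirical distribution $\mathbb P_0=\frac1N\sum_{n=1}^N\delta_{\xi^n}$, let $\epsilon>0$, and let $\mathcal D$ be the set of all probability distributions $f$ on $\mathbb R$ with $W(f,\mathbb P_0)\le\epsilon$, where $W(P,Q)$ is the infimum of $\mathbb E|\tilde\xi_1-\tilde\xi_2|$ over all joint distributions of $(\tilde\xi_1,\tilde\xi_2)$ with marginals $P$ and $Q$. Let $\mathcal X\subseteq\mathbb R^d$, let $T,c\in\mathbb R^d$ (with $T$ read as a row vector), let $\bar\alpha<1$, and let $g$ be a real-valued function. Consider the risk-adjustable distributionally robust chance-constrained problem $$z_0=\inf_{x\in\mathcal X,\ \alpha\in[0,\bar\alpha]}\Big\{c^\top x+g(\alpha):\ \inf_{f\in\mathcal D}\mathbb P_f(Tx\ge\xi)\ge 1-\alpha\Big\}.\qquad\text{(P)}$$ Let $\xi^0\ge\xi^1$ be a real number and consider the mixed 0-1 conic program $$\begin{aligned} z^c=\inf_{x\in\mathcal X,\,o,\,\alpha,\,u,\,w}\quad & c^\top x+g(\alpha)\\ \text{s.t.}\quad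 & uw\ \ge\ \sum_{0\le j\le k\le N-1}o_{jk}\sum_{i=j+1}^{k}(\xi^i-\xi^{k+1})+N\epsilon,\\ & u\le\alpha N-\sum_{j\le k}j\,o_{jk},\qquad w\le Tx-\sum_{j\le k}\xi^{k+1}o_{jk},\\ & \sum_{j\le k}\xi^{j}o_{jk}\ \ge\ Tx\ \ge\ \sum_{j\le k}\xi^{j+1}o_{jk},\\ & \sum_{j\le k}(k+1)\,o_{jk}\ \ge\ \alpha N\ \ge\ \sum_{j\le k}k\,o_{jk},\\ & \sum_{j\le k}o_{jk}=1,\qquad \alpha\in(0,\bar\alpha],\qquad u,w\ge0,\qquad o_{jk}\in\{0,1\}, \end{aligned}\qquad\text{(Q)}$$ where all sums run over $0\le j\le k\le N-1$. Infima of infeasible problems are $+\infty$. Then (P) and (Q) are equivalent in the following sense. (1) For all $x$ and $\alpha$: there are $o,u,w$ such that $(x,o,\alpha,u,w)$ is feasible for (Q) if and only if $(x,\alpha)$ is feasible for (P) and $Tx\le\xi^0$. (2) Suppose that $\xi^0$ is a valid upper bound, i.e. that $Tx\le\xi^0$ for every feasible $(x,\alpha)$ of (P), or that $Tx\le\xi^0$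 for at least one optimal solution $(x,\alpha)$ of (P). Then $z^c=z_0$, and for all $x$ and $\alpha$: there are $o,u,w$ such that $(x,o,\alpha,u,w)$ is optimal for (Q) if and only if $(x,\alpha)$ is optimal for (P) and $Tx\le\xi^0$. -/

import Mathlib

open MeasureTheory
open scoped ENNReal

noncomputable section

namespace RiskDRCC

/-- The Wasserstein distance of two measures on the real line: the infimum, over all joint
distributions with the given marginals, of the expected distance of the coordinates. -/
def wasserstein (P Q : Measure ℝ) : ℝ≥0∞ :=
  ⨅ (π : Measure (ℝ × ℝ)) (_ : π.map Prod.fst = P ∧ π.map Prod.snd = Q),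
    ∫⁻ z, ENNReal.ofReal |z.1 - z.2| ∂π

/-- The empirical distribution of the samples `ξ 1, …, ξ N`, each of mass `1 / N`. -/
def empirical (N : ℕ) (ξ : ℕ → ℝ) : Measure ℝ :=
  (N : ℝ≥0∞)⁻¹ • ∑ n ∈ Finset.Icc 1 N, Measure.dirac (ξ n)

/-- The Wasserstein ambiguity set: all probability distributions on the real line within
distance `ε` of the empirical distribution. -/
def ambiguitySet (N : ℕ) (ξ : ℕ → ℝ) (ε : ℝ) : Set (Measure ℝ) :=
  {f | IsProbabilityMeasure f ∧ wasserstein f (empirical N ξ) ≤ ENNReal.ofReal ε}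

/-- The feasible pairs `(x, α)` of the risk-adjustable distributionally robust
chance-constrained problem. -/
def DRCCFeasible {d : ℕ} (N : ℕ) (ξ : ℕ → ℝ) (ε αbar : ℝ) (X : Set (Fin d → ℝ))
    (T : Fin d → ℝ) (x : Fin d → ℝ) (α : ℝ) : Prop :=
  x ∈ X ∧ α ∈ Set.Icc 0 αbar ∧
    ENNReal.ofReal (1 - α) ≤ ⨅ f ∈ ambiguitySet N ξ ε, f {s : ℝ | s ≤ T ⬝ᵥ x}

/-- The common objective `cᵀ x + g α`. -/
def objective {d : ℕ} (c : Fin d → ℝ) (g : ℝ → ℝ) (x : Fin d → ℝ) (α : ℝ) : ℝ :=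
  c ⬝ᵥ x + g α

/-- The optimal value of the risk-adjustable problem (`⊤` if it is infeasible). -/
def drccValue {d : ℕ} (N : ℕ) (ξ : ℕ → ℝ) (ε αbar : ℝ) (X : Set (Fin d → ℝ))
    (T c : Fin d → ℝ) (g : ℝ → ℝ) : EReal :=
  sInf {z : EReal | ∃ x α, DRCCFeasible N ξ ε αbar X T x α ∧ z = (objective c g x α : ℝ)}

/-- `(x, α)` is an optimal solution of the risk-adjustable problem. -/
def DRCCOptimal {d : ℕ} (N : ℕ) (ξ : ℕ → ℝ) (ε αbar : ℝ) (X : Set (Fin d → ℝ))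
    (T c : Fin d → ℝ) (g : ℝ → ℝ) (x : Fin d → ℝ) (α : ℝ) : Prop :=
  DRCCFeasible N ξ ε αbar X T x α ∧
    ∀ x' α', DRCCFeasible N ξ ε αbar X T x' α' → objective c g x α ≤ objective c g x' α'

/-- The index pairs `(j, k)` with `0 ≤ j ≤ k ≤ N - 1`. -/
abbrev CritIdx (N : ℕ) : Type := {p : Fin N × Fin N // p.1 ≤ p.2}

/-- The index `j` of a pair `(j, k)`. -/
def CritIdx.j {N : ℕ} (p : CritIdx N) : ℕ := p.1.1

/-- The index `k` of a pair `(j, k)`. -/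
def CritIdx.k {N : ℕ} (p : CritIdx N) : ℕ := p.1.2

/-- The feasible points `(x, o, α, u, w)` of the mixed 0-1 conic program. Here `ξ 0` is the
upper bound that serves as the zeroth breakpoint, and `ξ 1, …, ξ N` are the samples. -/
structure MIPFeasible {d : ℕ} (N : ℕ) (ξ : ℕ → ℝ) (ε αbar : ℝ) (X : Set (Fin d → ℝ))
    (T : Fin d → ℝ) (x : Fin d → ℝ) (o : CritIdx N → ℝ) (α u w : ℝ) : Prop where
  mem : x ∈ X
  conic : (∑ p, o p * (∑ i ∈ Finset.Icc (p.j + 1) p.k, (ξ i - ξ (p.k + 1)))) + N * ε ≤ u * w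
  u_le : u ≤ α * N - ∑ p, (p.j : ℝ) * o p
  w_le : w ≤ T ⬝ᵥ x - ∑ p, ξ (p.k + 1) * o p
  Tx_le : T ⬝ᵥ x ≤ ∑ p, ξ p.j * o p
  le_Tx : ∑ p, ξ (p.j + 1) * o p ≤ T ⬝ᵥ x
  αN_le : α * N ≤ ∑ p, ((p.k : ℝ) + 1) * o p
  le_αN : ∑ p, (p.k : ℝ) * o p ≤ α * N
  sum_o : ∑ p, o p = 1
  α_mem : α ∈ Set.Ioc 0 αbar
  w_nonneg : 0 ≤ w
  u_nonneg : 0 ≤ u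
  binary : ∀ p, o p = 0 ∨ o p = 1

/-- The optimal value of the mixed 0-1 conic program (`⊤` if it is infeasible). -/
def mipValue {d : ℕ} (N : ℕ) (ξ : ℕ → ℝ) (ε αbar : ℝ) (X : Set (Fin d → ℝ))
    (T c : Fin d → ℝ) (g : ℝ → ℝ) : EReal :=
  sInf {z : EReal | ∃ x o α u w,
    MIPFeasible N ξ ε αbar X T x o α u w ∧ z = (objective c g x α : ℝ)}

/-- `(x, o, α, u, w)` is an optimal solution of the mixed 0-1 conic program. -/
def MIPOptimal {d : ℕ} (N : ℕ) (ξ : ℕ → ℝ) (ε αbar : ℝ) (X : Set (Fin d → ℝ))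
    (T c : Fin d → ℝ) (g : ℝ → ℝ) (x : Fin d → ℝ) (o : CritIdx N → ℝ) (α u w : ℝ) : Prop :=
  MIPFeasible N ξ ε αbar X T x o α u w ∧
    ∀ x' o' α' u' w', MIPFeasible N ξ ε αbar X T x' o' α' u' w' →
      objective c g x α ≤ objective c g x' α'

end RiskDRCC

end

/-! Write `t = T ⬝ᵥ x`. An adversary with budget `N * ε`, counting each sample as mass one, pushes
mass above `t`; sample `i` costs `max (t - ξ i) 0` per unit. The largest samples are cheapest, so
the chance constraint says that greedily moving mass `α * N` costs at least `N * ε`. With `k = ⌊α *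
N⌋₊` and `j` the last index up to `k` with `t ≤ ξ j`, the greedy cost is `(α * N - j) * (t - ξ (k +
1)) - ∑ (ξ i - ξ (k + 1))` over `j < i ≤ k`: the conic inequality with `u`, `w` at their upper
bounds. The binary `o` selects `(j, k)`. Necessity comes from explicit transport plans
(`le_transport_cost`, `le_greedy_cost`), sufficiency from weak duality (`mul_measure_Ioi_le`) with
multiplier `t - ξ (k + 1)`. -/

theorem RiskDRCC.binary_eq_single {ι : Type*} [Fintype ι] [DecidableEq ι] {o : ι → ℝ}
    (hb : ∀ p, o p = 0 ∨ o p = 1) (hs : ∑ p, o p = 1) : ∃ p, o = Pi.single p 1 := by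
  obtain ⟨p, hp⟩ : ∃ p, o p = 1 := by
    by_contra! h
    have : ∑ p, o p = 0 := Finset.sum_eq_zero fun p _ => (hb p).resolve_right (h p)
    linarith
  refine ⟨p, funext fun q => ?_⟩
  rcases eq_or_ne q p with rfl | hq
  · simpa using hp
  · rw [Pi.single_eq_of_ne hq]
    refine (hb q).resolve_right fun hq1 => ?_
    have h2 : ∑ i ∈ {q, p}, o i ≤ ∑ i, o i :=
      Finset.sum_le_sum_of_subset_of_nonneg (Finset.subset_univ _)
        fun i _ _ => by rcases hb i with h | h <;> simp [h]
    rw [Finset.sum_pair hq, hq1, hp, hs] at h2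
    norm_num at h2

namespace RiskDRCC

/-! ### Transport bounds for the half-line -/

theorem isProbabilityMeasure_empirical {N : ℕ} (hN : 0 < N) (ξ : ℕ → ℝ) :
    IsProbabilityMeasure (empirical N ξ) := by
  constructor
  simp only [empirical, Measure.smul_apply, Measure.finsetSum_apply, measure_univ,
    Finset.sum_const, Nat.card_Icc, smul_eq_mul, nsmul_eq_mul, mul_one, Nat.add_sub_cancel]
  exact ENNReal.inv_mul_cancel (by simpa using hN.ne') (by simp)

/-- Weak duality for the worst-case probability of the half-line above `t`. -/
theorem mul_measure_Ioi_le (N : ℕ) (ξ : ℕ → ℝ) (f : Measure ℝ) (t D : ℝ) :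
    ENNReal.ofReal D * f (Set.Ioi t) ≤ wasserstein f (empirical N ξ) +
      (N : ℝ≥0∞)⁻¹ * ∑ i ∈ Finset.Icc 1 N, ENNReal.ofReal (D - max (t - ξ i) 0) := by
  have hg : Measurable fun s : ℝ => ENNReal.ofReal (D - max (t - s) 0) := by fun_prop
  have hsum : (N : ℝ≥0∞)⁻¹ * ∑ i ∈ Finset.Icc 1 N, ENNReal.ofReal (D - max (t - ξ i) 0) =
      ∫⁻ s, ENNReal.ofReal (D - max (t - s) 0) ∂(empirical N ξ) := by
    rw [empirical, lintegral_smul_measure, lintegral_finsetSum_measure, smul_eq_mul]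
    simp
  rw [hsum]
  unfold wasserstein
  simp only [ENNReal.iInf_add]
  refine le_iInf₂ fun π hπ => ?_
  have hA : MeasurableSet (Prod.fst ⁻¹' Set.Ioi t : Set (ℝ × ℝ)) := measurable_fst measurableSet_Ioi
  nth_rewrite 1 [← hπ.1]
  rw [← hπ.2, lintegral_map hg measurable_snd, Measure.map_apply measurable_fst measurableSet_Ioi,
    ← lintegral_add_left (by fun_prop), ← lintegral_indicator_const hA]
  -- Pointwise, a coupling that brings `z.2` above `t` pays at least `max (t - z.2) 0`.
  refine lintegral_mono fun z => ?_
  by_cases hz : z ∈ (Prod.fst ⁻¹' Set.Ioi t : Set (ℝ × ℝ))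
  · rw [Set.indicator_of_mem hz]
    refine le_trans (ENNReal.ofReal_le_ofReal ?_) ENNReal.ofReal_add_le
    have h1 : t < z.1 := hz
    have : max (t - z.2) 0 ≤ |z.1 - z.2| :=
      max_le ((by linarith : t - z.2 ≤ z.1 - z.2).trans (le_abs_self _)) (abs_nonneg _)
    linarith
  · rw [Set.indicator_of_notMem hz]
    exact zero_le

/-- Moving the fraction `p i` of the `i`-th atom just above `t` shows that a distributionally
robust chance constraint bounds the cost of every such transport from below. -/
theorem le_transport_cost {N : ℕ} (hN : 0 < N) {ξ : ℕ → ℝ} {ε α t : ℝ}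
    (h : ENNReal.ofReal (1 - α) ≤ ⨅ f ∈ ambiguitySet N ξ ε, f {s : ℝ | s ≤ t})
    {p : ℕ → ℝ} (hp0 : ∀ i, 0 ≤ p i) (hp1 : ∀ i, p i ≤ 1)
    (hp : α * N < ∑ i ∈ Finset.Icc 1 N, p i) :
    N * ε ≤ ∑ i ∈ Finset.Icc 1 N, p i * max (t - ξ i) 0 := by
  by_contra! hlt
  have hN' : (0 : ℝ) < N := by exact_mod_cast hN
  have hNinv : (N : ℝ≥0∞)⁻¹ = ENNReal.ofReal ((N : ℝ)⁻¹) := by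
    rw [ENNReal.ofReal_inv_of_pos hN', ENNReal.ofReal_natCast]
  have hple : ∑ i ∈ Finset.Icc 1 N, p i ≤ N := by
    simpa using Finset.sum_le_sum fun i (_ : i ∈ Finset.Icc 1 N) => hp1 i
  set C := ∑ i ∈ Finset.Icc 1 N, p i * max (t - ξ i) 0 with hC
  -- The slack in the budget, spread over all `N` atoms: landing `δ` beyond `t` makes the violation
  -- strict, yet stays affordable even if every atom moves.
  set δ := (N * ε - C) / N with hδ
  have hδ0 : 0 < δ := div_pos (by linarith) hN'
  set π : Measure (ℝ × ℝ) := (N : ℝ≥0∞)⁻¹ • ∑ i ∈ Finset.Icc 1 N,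
    (ENNReal.ofReal (p i) • Measure.dirac (max (ξ i) t + δ, ξ i) +
      ENNReal.ofReal (1 - p i) • Measure.dirac (ξ i, ξ i)) with hπ
  have hint : ∀ F : ℝ × ℝ → ℝ≥0∞, Measurable F → ∫⁻ z, F z ∂π = (N : ℝ≥0∞)⁻¹ *
      ∑ i ∈ Finset.Icc 1 N, (ENNReal.ofReal (p i) * F (max (ξ i) t + δ, ξ i) +
        ENNReal.ofReal (1 - p i) * F (ξ i, ξ i)) := fun F hF => by
    rw [hπ, lintegral_smul_measure, lintegral_finsetSum_measure, smul_eq_mul]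
    simp [lintegral_add_measure, lintegral_smul_measure]
  have hsplit : ∀ i, ENNReal.ofReal (p i) + ENNReal.ofReal (1 - p i) = 1 := fun i => by
    rw [← ENNReal.ofReal_add (hp0 i) (by linarith [hp1 i])]
    simp
  have hsnd : π.map Prod.snd = empirical N ξ := by
    ext s hs
    rw [← lintegral_indicator_one hs, lintegral_map (measurable_one.indicator hs) measurable_snd,
      hint (fun z => s.indicator 1 z.2) ((measurable_one.indicator hs).comp measurable_snd), empirical]
    simp only [← add_mul, hsplit, one_mul]
    simp [hs]
  have hprob : IsProbabilityMeasure (π.map Prod.fst) := by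
    constructor
    have := (isProbabilityMeasure_empirical hN ξ).measure_univ
    rw [← hsnd, Measure.map_apply measurable_snd .univ] at this
    rw [Measure.map_apply measurable_fst .univ]
    exact this
  have hmem : π.map Prod.fst ∈ ambiguitySet N ξ ε := by
    refine ⟨hprob, (iInf₂_le π ⟨rfl, hsnd⟩).trans ?_⟩
    rw [hint _ (by fun_prop)]
    simp only [sub_self, abs_zero, ENNReal.ofReal_zero, mul_zero, add_zero]
    have hterm : ∀ i, ENNReal.ofReal (p i) * ENNReal.ofReal |max (ξ i) t + δ - ξ i| =
        ENNReal.ofReal (p i * (max (t - ξ i) 0 + δ)) := fun i => by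
      rw [ENNReal.ofReal_mul (hp0 i)]
      have : max (ξ i) t + δ - ξ i = max (t - ξ i) 0 + δ := by
        rw [max_comm, ← sub_self (ξ i), max_sub_sub_right]
        ring
      rw [this, abs_of_nonneg (by positivity)]
    simp only [hterm]
    rw [← ENNReal.ofReal_sum_of_nonneg fun i _ => mul_nonneg (hp0 i) (by positivity), hNinv,
      ← ENNReal.ofReal_mul (by positivity)]
    refine ENNReal.ofReal_le_ofReal ?_
    rw [inv_mul_le_iff₀ hN']
    simp only [mul_add, Finset.sum_add_distrib, ← Finset.sum_mul]
    rw [← hC]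
    have : (∑ i ∈ Finset.Icc 1 N, p i) * δ ≤ N * δ := by gcongr
    have h2 : N * δ = N * ε - C := by rw [hδ]; field_simp
    linarith
  have hle := h.trans (iInf₂_le _ hmem)
  have hms : MeasurableSet {s : ℝ | s ≤ t} := measurableSet_Iic
  rw [← lintegral_indicator_one hms, lintegral_map (measurable_one.indicator hms) measurable_fst,
      hint (fun z => {s : ℝ | s ≤ t}.indicator 1 z.1)
      ((measurable_one.indicator hms).comp measurable_fst)] at hle
  have hbound : (N : ℝ≥0∞)⁻¹ * ∑ i ∈ Finset.Icc 1 N,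
      (ENNReal.ofReal (p i) * {s : ℝ | s ≤ t}.indicator 1 (max (ξ i) t + δ) +
        ENNReal.ofReal (1 - p i) * {s : ℝ | s ≤ t}.indicator 1 (ξ i)) ≤
      ENNReal.ofReal ((N : ℝ)⁻¹ * ∑ i ∈ Finset.Icc 1 N, (1 - p i)) := by
    rw [ENNReal.ofReal_mul (by positivity), ← hNinv,
      ENNReal.ofReal_sum_of_nonneg fun i _ => by linarith [hp1 i]]
    gcongr with i
    have hni : max (ξ i) t + δ ∉ {s : ℝ | s ≤ t} := by
      have := le_max_right (ξ i) t
      simp only [Set.mem_ofPred_eq]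
      linarith
    rw [Set.indicator_of_notMem hni, mul_zero, zero_add]
    exact mul_le_of_le_one_right zero_le (Set.indicator_le_self' (by simp) _)
  have hnn : 0 ≤ (N : ℝ)⁻¹ * ∑ i ∈ Finset.Icc 1 N, (1 - p i) :=
    mul_nonneg (by positivity) (Finset.sum_nonneg fun i _ => by linarith [hp1 i])
  have hfin := (ENNReal.ofReal_le_ofReal_iff hnn).1 (hle.trans hbound)
  rw [Finset.sum_sub_distrib, ← div_eq_inv_mul, le_div_iff₀ hN'] at hfin
  simp at hfin
  linarith

/-- The greedy transport of the total fraction `α`, with `k = ⌊α N⌋`. -/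
theorem le_greedy_cost {N k : ℕ} (hN : 0 < N) (hk : k < N) {ξ : ℕ → ℝ} {ε α t : ℝ}
    (h : ENNReal.ofReal (1 - α) ≤ ⨅ f ∈ ambiguitySet N ξ ε, f {s : ℝ | s ≤ t})
    (hk0 : (k : ℝ) ≤ α * N) (hk1 : α * N < k + 1) :
    N * ε ≤ ∑ i ∈ Finset.Icc 1 k, max (t - ξ i) 0 + (α * N - k) * max (t - ξ (k + 1)) 0 := by
  -- The transport bound needs total mass strictly above `α * N`, so slightly more of atom `k + 1`
  -- is moved; then `β` decreases to `α * N - k`.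
  have key : ∀ β, α * N - k < β → β ≤ 1 →
      N * ε ≤ ∑ i ∈ Finset.Icc 1 k, max (t - ξ i) 0 + β * max (t - ξ (k + 1)) 0 := by
    intro β hβ hβ1
    let p : ℕ → ℝ := fun i => if i ≤ k then 1 else if i = k + 1 then β else 0
    have hsum : ∀ F : ℕ → ℝ, ∑ i ∈ Finset.Icc 1 N, p i * F i =
        ∑ i ∈ Finset.Icc 1 k, F i + β * F (k + 1) := by
      intro F
      have hsub : Finset.Icc 1 (k + 1) ⊆ Finset.Icc 1 N := Finset.Icc_subset_Icc le_rfl hk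
      rw [← Finset.sum_subset hsub, Finset.sum_Icc_succ_top (by lia)]
      · congr 1
        · refine Finset.sum_congr rfl fun i hi => ?_
          simp [p, (Finset.mem_Icc.1 hi).2]
        · simp [p]
      · intro i hi hi'
        simp only [Finset.mem_Icc] at hi hi'
        have h1 : ¬ i ≤ k := by lia
        have h2 : i ≠ k + 1 := by lia
        simp [p, h1, h2]
    have hp0 : ∀ i, 0 ≤ p i := fun i => by
      simp only [p]; split_ifs <;> linarith
    have hp1 : ∀ i, p i ≤ 1 := fun i => by
      simp only [p]; split_ifs <;> linarith
    rw [← hsum fun i => max (t - ξ i) 0]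
    refine le_transport_cost hN h hp0 hp1 ?_
    have := hsum fun _ => 1
    simp at this
    linarith
  have hD : 0 ≤ max (t - ξ (k + 1)) 0 := le_max_right _ _
  have hcont : Filter.Tendsto
      (fun β => ∑ i ∈ Finset.Icc 1 k, max (t - ξ i) 0 + β * max (t - ξ (k + 1)) 0)
      (nhdsWithin (α * N - k) (Set.Ioi (α * N - k))) (nhds
        (∑ i ∈ Finset.Icc 1 k, max (t - ξ i) 0 + (α * N - k) * max (t - ξ (k + 1)) 0)) :=
    Filter.Tendsto.mono_left (Continuous.tendsto (by fun_prop) _) nhdsWithin_le_nhds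
  refine ge_of_tendsto hcont ?_
  filter_upwards [Ioc_mem_nhdsGT (show α * N - k < 1 by linarith)] with β hβ
  exact key β hβ.1 hβ.2

/-! ### Breakpoints and the conic inequality -/

/-- Evaluates the dual sum: samples up to `j` move for free, those in `(j, k]` cost `t - ξ i`, and
those beyond `k` cost at least the multiplier, so they contribute nothing. -/
theorem sum_transport_threshold {N j k : ℕ} (hjk : j ≤ k) (hk : k < N) {ξ : ℕ → ℝ}
    (hξ : AntitoneOn ξ (Set.Icc 0 N)) {t : ℝ} (htj : t ≤ ξ j) (htj' : ξ (j + 1) ≤ t) :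
    ∑ i ∈ Finset.Icc 1 N, max (t - ξ (k + 1) - max (t - ξ i) 0) 0 =
      j * (t - ξ (k + 1)) + ∑ i ∈ Finset.Icc (j + 1) k, (ξ i - ξ (k + 1)) := by
  have hanti : ∀ a b, a ≤ b → b ≤ N → ξ b ≤ ξ a := fun a b hab hb =>
    hξ ⟨zero_le, hab.trans hb⟩ ⟨zero_le, hb⟩ hab
  have hIcc : ∀ n, Finset.Icc 1 n = Finset.Ioc 0 n := fun n => by
    ext
    simp only [Finset.mem_Icc, Finset.mem_Ioc]
    lia
  have hIcc' : Finset.Icc (j + 1) k = Finset.Ioc j k := by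
    ext
    simp only [Finset.mem_Icc, Finset.mem_Ioc]
    lia
  have ht : ξ (k + 1) ≤ t := (hanti _ _ (by lia) (by lia)).trans htj'
  rw [hIcc, hIcc', ← Finset.sum_Ioc_consecutive _ (zero_le : 0 ≤ k) hk.le,
    ← Finset.sum_Ioc_consecutive _ (zero_le : 0 ≤ j) hjk]
  have h1 : ∑ i ∈ Finset.Ioc 0 j, max (t - ξ (k + 1) - max (t - ξ i) 0) 0 =
      j * (t - ξ (k + 1)) := by
    rw [Finset.sum_congr rfl (g := fun _ => t - ξ (k + 1))]
    · simp [mul_sub]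
    · intro i hi
      have := hanti i j (Finset.mem_Ioc.1 hi).2 (by lia)
      rw [max_eq_right (by linarith : t - ξ i ≤ 0), max_eq_left (by linarith)]
      ring
  have h2 : ∑ i ∈ Finset.Ioc j k, max (t - ξ (k + 1) - max (t - ξ i) 0) 0 =
      ∑ i ∈ Finset.Ioc j k, (ξ i - ξ (k + 1)) := by
    refine Finset.sum_congr rfl fun i hi => ?_
    have hi := Finset.mem_Ioc.1 hi
    have := hanti (j + 1) i (by lia) (by lia)
    have := hanti i (k + 1) (by lia) (by lia)
    rw [max_eq_left (by linarith : 0 ≤ t - ξ i), max_eq_left (by linarith)]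
    ring
  have h3 : ∑ i ∈ Finset.Ioc k N, max (t - ξ (k + 1) - max (t - ξ i) 0) 0 = 0 := by
    refine Finset.sum_eq_zero fun i hi => ?_
    have hi := Finset.mem_Ioc.1 hi
    have := hanti (k + 1) i (by lia) (by lia)
    rw [max_eq_left (by linarith : 0 ≤ t - ξ i), max_eq_right (by linarith)]
  rw [h1, h2, h3, add_zero]

/-- The conic inequality at a breakpoint pair implies the chance constraint. -/
theorem chance_of_conic {N j k : ℕ} (hN : 0 < N) (hjk : j ≤ k) (hk : k < N) {ξ : ℕ → ℝ}
    (hξ : AntitoneOn ξ (Set.Icc 0 N)) {ε α t : ℝ} (hε : 0 < ε)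
    (htj : t ≤ ξ j) (htj' : ξ (j + 1) ≤ t) (hD : 0 < t - ξ (k + 1))
    (hconic : ∑ i ∈ Finset.Icc (j + 1) k, (ξ i - ξ (k + 1)) + N * ε ≤
      (α * N - j) * (t - ξ (k + 1))) :
    ENNReal.ofReal (1 - α) ≤ ⨅ f ∈ ambiguitySet N ξ ε, f {s : ℝ | s ≤ t} := by
  refine le_iInf₂ fun f hf => ?_
  have hN' : (0 : ℝ) < N := by exact_mod_cast hN
  have := hf.1
  -- The multiplier is the unit cost of the marginal sample `k + 1`.
  have hdual := (mul_measure_Ioi_le N ξ f t (t - ξ (k + 1))).trans (add_le_add_left hf.2 _)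
  have hS := sum_transport_threshold hjk hk hξ htj htj'
  have hNinv : (N : ℝ≥0∞)⁻¹ = ENNReal.ofReal ((N : ℝ)⁻¹) := by
    rw [ENNReal.ofReal_inv_of_pos hN', ENNReal.ofReal_natCast]
  have hmax : ∀ i, ENNReal.ofReal (t - ξ (k + 1) - max (t - ξ i) 0) =
      ENNReal.ofReal (max (t - ξ (k + 1) - max (t - ξ i) 0) 0) := fun i => by simp
  simp only [hmax] at hdual
  rw [← ENNReal.ofReal_sum_of_nonneg fun _ _ => le_max_right _ _, hNinv,
    ← ENNReal.ofReal_mul (by positivity), hS] at hdual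
  have hSnn : 0 ≤ (N : ℝ)⁻¹ *
      (j * (t - ξ (k + 1)) + ∑ i ∈ Finset.Icc (j + 1) k, (ξ i - ξ (k + 1))) := by
    rw [← hS]
    exact mul_nonneg (by positivity) (Finset.sum_nonneg fun _ _ => le_max_right _ _)
  rw [← ENNReal.ofReal_add hε.le hSnn, ← ofReal_measureReal,
    ← ENNReal.ofReal_mul hD.le, ENNReal.ofReal_le_ofReal_iff (by positivity)] at hdual
  have hle : f.real (Set.Ioi t) ≤ α := by
    have h1 : ε + (N : ℝ)⁻¹ *
        (j * (t - ξ (k + 1)) + ∑ i ∈ Finset.Icc (j + 1) k, (ξ i - ξ (k + 1))) ≤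
        (t - ξ (k + 1)) * α := by
      rw [← sub_nonneg]
      have : (t - ξ (k + 1)) * α - (ε + (N : ℝ)⁻¹ *
        (j * (t - ξ (k + 1)) + ∑ i ∈ Finset.Icc (j + 1) k, (ξ i - ξ (k + 1)))) =
        (N : ℝ)⁻¹ * ((α * N - j) * (t - ξ (k + 1)) -
          (∑ i ∈ Finset.Icc (j + 1) k, (ξ i - ξ (k + 1)) + N * ε)) := by
        field_simp
        ring
      rw [this]
      exact mul_nonneg (by positivity) (by linarith)
    exact le_of_mul_le_mul_left (hdual.trans h1) hD
  have hcompl : {s : ℝ | s ≤ t} = (Set.Ioi t)ᶜ := by ext; simp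
  rw [hcompl, ← ofReal_measureReal, probReal_compl_eq_one_sub measurableSet_Ioi]
  exact ENNReal.ofReal_le_ofReal (by linarith)

/-- The chance constraint gives a breakpoint pair at which the conic inequality holds. -/
theorem exists_conic_of_chance {N : ℕ} (hN : 0 < N) {ξ : ℕ → ℝ}
    (hξ : AntitoneOn ξ (Set.Icc 0 N)) {ε α t : ℝ} (hε : 0 < ε) (hα : 0 ≤ α) (hα1 : α < 1)
    (ht : t ≤ ξ 0)
    (h : ENNReal.ofReal (1 - α) ≤ ⨅ f ∈ ambiguitySet N ξ ε, f {s : ℝ | s ≤ t}) :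
    0 < α ∧ ∃ j k, j ≤ k ∧ k < N ∧ t ≤ ξ j ∧ ξ (j + 1) ≤ t ∧ 0 < t - ξ (k + 1) ∧
      (k : ℝ) ≤ α * N ∧ α * N ≤ k + 1 ∧
      ∑ i ∈ Finset.Icc (j + 1) k, (ξ i - ξ (k + 1)) + N * ε ≤
        (α * N - j) * (t - ξ (k + 1)) := by
  have hN' : (0 : ℝ) < N := by exact_mod_cast hN
  have hanti : ∀ a b, a ≤ b → b ≤ N → ξ b ≤ ξ a := fun a b hab hb =>
    hξ ⟨zero_le, hab.trans hb⟩ ⟨zero_le, hb⟩ hab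
  have hk0 : (⌊α * N⌋₊ : ℝ) ≤ α * N := Nat.floor_le (by positivity)
  have hk1 : α * N < ⌊α * N⌋₊ + 1 := Nat.lt_floor_add_one _
  generalize ⌊α * N⌋₊ = k at hk0 hk1
  have hk : k < N := by
    have : (k : ℝ) < N := hk0.trans_lt (by nlinarith)
    exact_mod_cast this
  have hG := le_greedy_cost hN hk h hk0 hk1
  have hNε : 0 < N * ε := by positivity
  -- Otherwise the first `k + 1` samples all move for free, contradicting `0 < N * ε`.
  have hD : 0 < t - ξ (k + 1) := by
    by_contra! hD
    have h0 : ∑ i ∈ Finset.Icc 1 k, max (t - ξ i) 0 = 0 := Finset.sum_eq_zero fun i hi => by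
      have := hanti i (k + 1) (by have := (Finset.mem_Icc.1 hi).2; lia) hk
      exact max_eq_right (by linarith)
    rw [h0, max_eq_right hD] at hG
    linarith
  refine ⟨?_, ?_⟩
  · rcases hα.eq_or_lt with rfl | hα
    · have : k = 0 := by
        have : (k : ℝ) ≤ 0 := by simpa using hk0
        exact_mod_cast this.antisymm (Nat.cast_nonneg k)
      subst this
      simp at hG
      linarith
    · exact hα
  · classical
    -- Index `0` qualifies because `t ≤ ξ 0`. When the cap `k` is attained, `ξ (j + 1) ≤ t` comes
    -- from `hD` instead of maximality.
    let j := Nat.findGreatest (fun j => t ≤ ξ j) k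
    have hjk : j ≤ k := Nat.findGreatest_le k
    have htj : t ≤ ξ j := Nat.findGreatest_spec (P := fun j => t ≤ ξ j) zero_le ht
    have htj' : ξ (j + 1) ≤ t := by
      rcases hjk.eq_or_lt with hj | hj
      · rw [hj]; linarith
      · exact (not_le.1 (Nat.findGreatest_is_greatest (P := fun j => t ≤ ξ j)
          (Nat.lt_succ_self j) hj)).le
    refine ⟨j, k, hjk, hk, htj, htj', hD, hk0, hk1.le, ?_⟩
    clear_value j
    rw [max_eq_left hD.le] at hG
    have hIcc : Finset.Icc 1 k = Finset.Ioc 0 k := by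
      ext
      simp only [Finset.mem_Icc, Finset.mem_Ioc]
      lia
    have hIcc' : Finset.Icc (j + 1) k = Finset.Ioc j k := by
      ext
      simp only [Finset.mem_Icc, Finset.mem_Ioc]
      lia
    have h1 : ∑ i ∈ Finset.Ioc 0 j, max (t - ξ i) 0 = 0 := Finset.sum_eq_zero fun i hi => by
      have := hanti i j (Finset.mem_Ioc.1 hi).2 (by lia)
      exact max_eq_right (by linarith)
    have h2 : ∑ i ∈ Finset.Ioc j k, max (t - ξ i) 0 =
        (k - j) * (t - ξ (k + 1)) - ∑ i ∈ Finset.Ioc j k, (ξ i - ξ (k + 1)) := by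
      rw [eq_sub_iff_add_eq, ← Finset.sum_add_distrib,
        Finset.sum_congr rfl (g := fun _ => t - ξ (k + 1))]
      · simp [Nat.cast_sub hjk, mul_sub]
      · intro i hi
        have hi := Finset.mem_Ioc.1 hi
        have := hanti (j + 1) i (by lia) (by lia)
        rw [max_eq_left (by linarith)]
        ring
    rw [hIcc, ← Finset.sum_Ioc_consecutive _ (zero_le : 0 ≤ j) hjk, h1, h2] at hG
    rw [hIcc']
    linarith

/-! ### Equivalence of the two problems -/

theorem exists_mipFeasible_iff {d : ℕ} {N : ℕ} (hN : 0 < N) {ξ : ℕ → ℝ}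
    (hξ : AntitoneOn ξ (Set.Icc 0 N)) {ε : ℝ} (hε : 0 < ε) {αbar : ℝ} (hαbar : αbar < 1)
    (X : Set (Fin d → ℝ)) (T x : Fin d → ℝ) (α : ℝ) :
    (∃ o u w, MIPFeasible N ξ ε αbar X T x o α u w) ↔
      DRCCFeasible N ξ ε αbar X T x α ∧ T ⬝ᵥ x ≤ ξ 0 := by
  have hNε : 0 < N * ε := mul_pos (by exact_mod_cast hN) hε
  have hanti : ∀ a b, a ≤ b → b ≤ N → ξ b ≤ ξ a := fun a b hab hb =>
    hξ ⟨zero_le, hab.trans hb⟩ ⟨zero_le, hb⟩ hab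
  constructor
  · rintro ⟨o, u, w, h⟩
    classical
    obtain ⟨p, rfl⟩ := binary_eq_single h.binary h.sum_o
    have hconic := h.conic
    have hu := h.u_le
    have hw := h.w_le
    have h1 := h.Tx_le
    have h2 := h.le_Tx
    simp only [Pi.single_apply, ite_mul, mul_ite, one_mul, mul_one, zero_mul, mul_zero,
      Finset.sum_ite_eq', Finset.mem_univ, if_true] at hconic hu hw h1 h2
    have hjk : p.j ≤ p.k := p.2
    have hk : p.k < N := p.1.2.2
    have hS : 0 ≤ ∑ i ∈ Finset.Icc (p.j + 1) p.k, (ξ i - ξ (p.k + 1)) :=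
      Finset.sum_nonneg fun i hi => by
        have := hanti i (p.k + 1) (by have := (Finset.mem_Icc.1 hi).2; lia) hk
        linarith
    -- Positivity of `N * ε` forces `w > 0`, hence the strict gap `ξ (p.k + 1) < T ⬝ᵥ x` needed to
    -- divide by the multiplier.
    have huw : 0 < u * w := by linarith
    have hw0 : 0 < w := h.w_nonneg.lt_of_ne (by rintro rfl; simp at huw)
    have hmul : u * w ≤ (α * N - p.j) * (T ⬝ᵥ x - ξ (p.k + 1)) :=
      mul_le_mul hu hw h.w_nonneg (h.u_nonneg.trans hu)
    refine ⟨⟨h.mem, ⟨h.α_mem.1.le, h.α_mem.2⟩, ?_⟩, h1.trans (hanti 0 p.j zero_le (by lia))⟩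
    exact chance_of_conic hN hjk hk hξ hε h1 h2 (by linarith) (by linarith)
  · rintro ⟨⟨hx, hα, h⟩, ht⟩
    obtain ⟨hα0, j, k, hjk, hk, htj, htj', hD, hk0, hk1, hconic⟩ :=
      exists_conic_of_chance hN hξ hε hα.1 (hα.2.trans_lt hαbar) ht h
    classical
    have hjk' : (j : ℝ) ≤ k := by exact_mod_cast hjk
    let p : CritIdx N := ⟨(⟨j, by lia⟩, ⟨k, hk⟩), hjk⟩
    have hpj : p.j = j := rfl
    have hpk : p.k = k := rfl
    -- Both `u` and `w` take their upper bounds, the choice most favourable to the conic constraint.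
    refine ⟨Pi.single p 1, α * N - j, T ⬝ᵥ x - ξ (k + 1),
      ⟨hx, ?_, ?_, ?_, ?_, ?_, ?_, ?_, ?_, ⟨hα0, hα.2⟩, hD.le, by linarith, fun q => ?_⟩⟩
    on_goal 9 => rcases eq_or_ne q p with rfl | hq <;> simp [*]
    all_goals
      simp only [Pi.single_apply, ite_mul, mul_ite, one_mul, mul_one, zero_mul, mul_zero,
        Finset.sum_ite_eq', Finset.mem_univ, if_true, hpj, hpk]
      try first | assumption | exact le_rfl

end RiskDRCC

theorem theorem2 {d : ℕ} (N : ℕ) (hN : 0 < N) (ξ : ℕ → ℝ)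
    -- `ξ 1 ≥ ⋯ ≥ ξ N` are the ordered samples and `ξ 0 ≥ ξ 1` is the upper bound
    (hξ : AntitoneOn ξ (Set.Icc 0 N))
    (ε : ℝ) (hε : 0 < ε) (αbar : ℝ) (hαbar : αbar < 1)
    (X : Set (Fin d → ℝ)) (T c : Fin d → ℝ) (g : ℝ → ℝ) :
    -- the feasible set of the conic program projects onto the feasible set of the problem
    (∀ x α, (∃ o u w, RiskDRCC.MIPFeasible N ξ ε αbar X T x o α u w) ↔
      RiskDRCC.DRCCFeasible N ξ ε αbar X T x α ∧ T ⬝ᵥ x ≤ ξ 0) ∧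
    -- if `ξ 0` bounds `T x` at all feasible points, or at some optimal solution, then the
    -- optimal values agree and the optimal solutions correspond
    (((∀ x α, RiskDRCC.DRCCFeasible N ξ ε αbar X T x α → T ⬝ᵥ x ≤ ξ 0) ∨
      (∃ x α, RiskDRCC.DRCCOptimal N ξ ε αbar X T c g x α ∧ T ⬝ᵥ x ≤ ξ 0)) →
      RiskDRCC.mipValue N ξ ε αbar X T c g = RiskDRCC.drccValue N ξ ε αbar X T c g ∧
      (∀ x α, (∃ o u w, RiskDRCC.MIPOptimal N ξ ε αbar X T c g x o α u w) ↔
        RiskDRCC.DRCCOptimal N ξ ε αbar X T c g x α ∧ T ⬝ᵥ x ≤ ξ 0)) := by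
  have key := fun x α => RiskDRCC.exists_mipFeasible_iff hN hξ hε hαbar X T x α
  refine ⟨key, fun hbound => ?_⟩
  have hmip : ∀ {x o α u w}, RiskDRCC.MIPFeasible N ξ ε αbar X T x o α u w →
      RiskDRCC.DRCCFeasible N ξ ε αbar X T x α ∧ T ⬝ᵥ x ≤ ξ 0 :=
    fun h => (key _ _).1 ⟨_, _, _, h⟩
  -- every feasible point of the problem is dominated by one below the breakpoint `ξ 0`
  have hdom : ∀ x α, RiskDRCC.DRCCFeasible N ξ ε αbar X T x α →
      ∃ x' o' α' u' w', RiskDRCC.MIPFeasible N ξ ε αbar X T x' o' α' u' w' ∧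
        RiskDRCC.objective c g x' α' ≤ RiskDRCC.objective c g x α := by
    intro x α hx
    rcases hbound with hb | ⟨y, β, hy, hyb⟩
    · obtain ⟨o, u, w, h⟩ := (key x α).2 ⟨hx, hb x α hx⟩
      exact ⟨x, o, α, u, w, h, le_rfl⟩
    · obtain ⟨o, u, w, h⟩ := (key y β).2 ⟨hy.1, hyb⟩
      exact ⟨y, o, β, u, w, h, hy.2 x α hx⟩
  refine ⟨le_antisymm ?_ ?_, fun x α => ⟨?_, ?_⟩⟩
  · refine le_sInf ?_
    rintro _ ⟨x, α, hx, rfl⟩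
    obtain ⟨x', o', α', u', w', h, hle⟩ := hdom x α hx
    refine sInf_le_of_le ?_ (EReal.coe_le_coe_iff.2 hle)
    exact ⟨x', o', α', u', w', h, rfl⟩
  · refine sInf_le_sInf ?_
    rintro _ ⟨x, o, α, u, w, h, rfl⟩
    exact ⟨x, α, (hmip h).1, rfl⟩
  · rintro ⟨o, u, w, h, hopt⟩
    refine ⟨⟨(hmip h).1, fun x' α' hx' => ?_⟩, (hmip h).2⟩
    obtain ⟨y, o', β, u', w', hy, hle⟩ := hdom x' α' hx'
    exact (hopt y o' β u' w' hy).trans hle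
  · rintro ⟨⟨hx, hopt⟩, ht⟩
    obtain ⟨o, u, w, h⟩ := (key x α).2 ⟨hx, ht⟩
    exact ⟨o, u, w, h, fun x' o' α' u' w' h' => hopt x' α' (hmip h').1⟩
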